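/- For $n\ge 1$ let $T_n$ be the rooted tree whose root has a single child, this child being the root of a complete binary tree with $n-1$ levels (so $T_n$ has $2^{n-1}$ leaves, all at distance $n$ from the root). An edge of $T_n$ has depth $d$ if there are $d$ edges on the path that starts with this edge and ends at the root. Let $0<a<b$, and let $(X_e)_{e\in E(T_n)}$ be independent, identically distributed random variables with values in $[a,b]$. Give each edge $e$ of depth $d$ the resistance $r_e=2^{d-1}X_e$, and let $R_n$ be the effective resistance of this electric network between the root and the set of leaves, that is, $R_n=1/C_n$, where $C_n=\sum_{v\sim r}\bigl(U(r)-U(v)\bigr)/r_{rv}$ is the total current leaving the root $r$ for the unique potential $U$ that equals $1$ at the root and $0$ at the leaves and satisfies $\sum_{v\sim u}\bigl(U(u)-U(v)\bigr)/r_{uv}=0$ at every other vertex $u$. Then there is a constant $C>0$ depending only on $a$ and $b$ such that, for all $n\ge 1$, the variable $R_n$ is integrable and, for all $t>0$, $$\mathbf P\bigl(|R_n-\mathbf E R_n|>t\bigr)\le 2\exp\Bigl(-\frac{t^2}{4C}\Bigr).$$ -/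

import Mathlib

open MeasureTheory ProbabilityTheory

/-! ### Effective resistance of a finite electric network -/

namespace ElectricNetwork

variable {V : Type*}

open Classical in
/-- Ohm's law: the current `i(u, v) = (U(u) - U(v)) / r_e` that the potential `U` drives from `u`
to `v` through the edge `e = uv`; it is `0` when `u` and `v` are not joined by an edge. -/
noncomputable def current (G : SimpleGraph V) (r : G.edgeSet → ℝ) (U : V → ℝ) (u v : V) : ℝ :=
  if h : G.Adj u v then (U u - U v) / r ⟨s(u, v), h⟩ else 0

/-- `U` is a voltage function for the pair `(A, B)`: it is `1` on `A`, it is `0` on `B`, and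
Kirchhoff's node law holds at every vertex outside `A ∪ B`. -/
structure IsVoltage [Fintype V] (G : SimpleGraph V) (r : G.edgeSet → ℝ) (A B : Set V) (U : V → ℝ) :
    Prop where
  eq_one : ∀ u ∈ A, U u = 1
  eq_zero : ∀ v ∈ B, U v = 0
  node_law : ∀ u, u ∉ A → u ∉ B → ∑ v, current G r U u v = 0

lemma current_swap (G : SimpleGraph V) (r : G.edgeSet → ℝ) (U : V → ℝ) (u v : V) :
    current G r U v u = - current G r U u v := by
  unfold current
  by_cases h : G.Adj u v
  · have e : (⟨s(v, u), h.symm⟩ : G.edgeSet) = ⟨s(u, v), h⟩ := Subtype.ext Sym2.eq_swap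
    rw [dif_pos h, dif_pos h.symm, e]
    ring
  · rw [dif_neg h, dif_neg (fun h' => h h'.symm), neg_zero]

variable [Fintype V]

lemma eq_zero_of_harmonic (G : SimpleGraph V) (hG : G.Connected) (r : G.edgeSet → ℝ)
    (hr : ∀ e, 0 < r e) (S : Set V) (hS : S.Nonempty) (U : V → ℝ) (h0 : ∀ u ∈ S, U u = 0)
    (h1 : ∀ u, u ∉ S → ∑ v, current G r U u v = 0) : U = 0 := by
  have hsum : ∑ u, ∑ v, U u * current G r U u v = 0 := by
    refine Finset.sum_eq_zero fun u _ => ?_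
    rw [← Finset.mul_sum]
    by_cases hu : u ∈ S
    · rw [h0 u hu, zero_mul]
    · rw [h1 u hu, mul_zero]
  have hsum' : ∑ u, ∑ v, U v * current G r U u v = 0 := by
    rw [Finset.sum_comm, ← neg_eq_zero, ← Finset.sum_neg_distrib, ← hsum]
    refine Finset.sum_congr rfl fun u _ => ?_
    rw [← Finset.sum_neg_distrib]
    refine Finset.sum_congr rfl fun v _ => ?_
    rw [current_swap G r U u v]
    ring
  have hE : ∑ u, ∑ v, (U u - U v) * current G r U u v = 0 := by
    simp only [sub_mul, Finset.sum_sub_distrib, hsum, hsum', sub_zero]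
  have hnn : ∀ u v, 0 ≤ (U u - U v) * current G r U u v := by
    intro u v
    unfold current
    split_ifs with h
    · rw [← mul_div_assoc]
      exact div_nonneg (mul_self_nonneg _) (hr _).le
    · simp
  have hadj : ∀ u v, G.Adj u v → U u = U v := by
    intro u v h
    have h2 := (Finset.sum_eq_zero_iff_of_nonneg
      (fun u _ => Finset.sum_nonneg fun v _ => hnn u v)).1 hE u (Finset.mem_univ _)
    have h3 := (Finset.sum_eq_zero_iff_of_nonneg (fun v _ => hnn u v)).1 h2 v (Finset.mem_univ _)
    unfold current at h3
    rw [dif_pos h, ← mul_div_assoc, div_eq_zero_iff] at h3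
    rcases h3 with h3 | h3
    · exact sub_eq_zero.1 (mul_self_eq_zero.1 h3)
    · exact absurd h3 (hr _).ne'
  obtain ⟨s, hs⟩ := hS
  funext u
  obtain ⟨p⟩ := hG.preconnected u s
  have : U u = U s := by
    induction p with
    | nil => rfl
    | cons h _ ih => exact (hadj _ _ h).trans (ih hs)
  rw [this, h0 s hs, Pi.zero_apply]

open Classical in
/-- In a connected finite network with positive resistances the voltage function exists and is
unique, so that the definitions below are unambiguous. -/
theorem existsUnique_isVoltage (G : SimpleGraph V) (hG : G.Connected) (r : G.edgeSet → ℝ)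
    (hr : ∀ e, 0 < r e) (A B : Set V) (hAB : Disjoint A B) (hne : (A ∪ B).Nonempty) :
    ∃! U : V → ℝ, IsVoltage G r A B U := by
  let L : (V → ℝ) →ₗ[ℝ] (V → ℝ) :=
    { toFun := fun U u => if u ∈ A ∪ B then U u else ∑ v, current G r U u v
      map_add' := by
        intro U W
        funext u
        simp only [Pi.add_apply]
        split_ifs with h
        · rfl
        · rw [← Finset.sum_add_distrib]
          refine Finset.sum_congr rfl fun v _ => ?_
          unfold current
          split_ifs
          · simp only [Pi.add_apply]
            ring
          · ring
      map_smul' := by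
        intro c U
        funext u
        simp only [Pi.smul_apply, smul_eq_mul, RingHom.id_apply]
        split_ifs with h
        · rfl
        · rw [Finset.mul_sum]
          refine Finset.sum_congr rfl fun v _ => ?_
          unfold current
          split_ifs
          · simp only [Pi.smul_apply, smul_eq_mul]
            ring
          · ring }
  have hL : ∀ U u, L U u = if u ∈ A ∪ B then U u else ∑ v, current G r U u v := fun _ _ => rfl
  have hinj : Function.Injective L := by
    rw [injective_iff_map_eq_zero]
    intro U hU
    refine eq_zero_of_harmonic G hG r hr (A ∪ B) hne U (fun u hu => ?_) (fun u hu => ?_)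
    · have := congrFun hU u
      rwa [hL, if_pos hu] at this
    · have := congrFun hU u
      rwa [hL, if_neg hu] at this
  have key : ∀ U, IsVoltage G r A B U ↔ L U = fun u => if u ∈ A then 1 else 0 := by
    intro U
    constructor
    · intro h
      funext u
      rw [hL]
      by_cases hA : u ∈ A
      · simp [hA, h.eq_one u hA]
      · by_cases hB : u ∈ B
        · simp [hA, hB, h.eq_zero u hB]
        · simp [hA, hB, h.node_law u hA hB]
    · intro h
      refine ⟨fun u hA => ?_, fun u hB => ?_, fun u hA hB => ?_⟩
      · have := congrFun h u
        simpa [hL, hA] using this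
      · have := congrFun h u
        have hA : u ∉ A := fun hA => Set.disjoint_left.1 hAB hA hB
        simpa [hL, hA, hB] using this
      · have := congrFun h u
        simpa [hL, hA, hB] using this
  obtain ⟨U, hU⟩ := LinearMap.surjective_of_injective hinj (fun u => if u ∈ A then 1 else 0)
  exact ⟨U, (key U).2 hU, fun W hW => hinj (((key W).1 hW).trans hU.symm)⟩

/-- The voltage function of the network for the pair `(A, B)`. -/
noncomputable def voltage (G : SimpleGraph V) (r : G.edgeSet → ℝ) (A B : Set V) : V → ℝ :=
  Classical.epsilon (IsVoltage G r A B)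

open Classical in
/-- The effective conductance `C(A ↔ B)`: the total current flowing into the network. -/
noncomputable def effectiveConductance (G : SimpleGraph V) (r : G.edgeSet → ℝ) (A B : Set V) :
    ℝ :=
  ∑ u with u ∈ A, ∑ v, current G r (voltage G r A B) u v

/-- The effective resistance `R(A ↔ B) = 1 / C(A ↔ B)`. -/
noncomputable def effectiveResistance (G : SimpleGraph V) (r : G.edgeSet → ℝ) (A B : Set V) :
    ℝ :=
  1 / effectiveConductance G r A B

end ElectricNetwork

/-! ### The binary tree rooted at an edge -/

namespace EdgeRootedTree

/-- Binary words of length less than `n`, the nodes of the complete binary tree with `n - 1`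
levels of edges. -/
abbrev Word (n : ℕ) : Type := {w : List Bool // w.length < n}

noncomputable instance (n : ℕ) : Fintype (Word n) :=
  (List.finite_length_lt Bool n).fintype

/-- The vertices of `T_n`: the root `none`, and the nodes of the complete binary tree hanging
below the root, the top of which is the empty word. -/
abbrev Vertex (n : ℕ) : Type := Option (Word n)

/-- `IsChild u v` says that `v` is a child of `u`: the only child of the root is the empty word,
and the children of a word `w` are its two extensions by one letter. -/
def IsChild {n : ℕ} : Vertex n → Vertex n → Prop
  | none, some w => w.1 = []
  | some w, some w' => ∃ c : Bool, w'.1 = w.1 ++ [c]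
  | _, none => False

/-- The tree `T_n`, in which every vertex is joined to its children. -/
def tree (n : ℕ) : SimpleGraph (Vertex n) := SimpleGraph.fromRel IsChild

/-- The depth of a vertex, that is, its distance from the root. -/
def depth {n : ℕ} : Vertex n → ℕ
  | none => 0
  | some w => w.1.length + 1

/-- The depth of an edge, that is, the number of edges on the path that starts with this edge and
ends at the root; it is the depth of the lower endpoint. -/
def edgeDepth {n : ℕ} (e : (tree n).edgeSet) : ℕ := (e.1.map depth).sup

/-- The leaves of `T_n` are the vertices at depth `n`. -/
def leaves (n : ℕ) : Set (Vertex n) := {v | depth v = n}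

/-- The effective resistance `R_n` between the root and the leaves of `T_n`, when every edge `e`
at depth `d` has the resistance `2 ^ (d - 1) * x e`. -/
noncomputable def resistance (n : ℕ) (x : (tree n).edgeSet → ℝ) : ℝ :=
  ElectricNetwork.effectiveResistance (tree n) (fun e => 2 ^ (edgeDepth e - 1) * x e)
    {none} (leaves n)

end EdgeRootedTree

/-! The resistance is a function of independent edge weights, so McDiarmid's inequality gives a
Gaussian tail whose variance proxy is a quarter of the sum of the squared oscillations in the single
weights. The point is to bound that sum independently of `n`.

By the series and parallel laws, and thanks to the factors `2 ^ (d - 1)`, the normalized resistance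
`S` of a tree is the weight of its top edge plus the harmonic mean of the normalized resistances of
its two branches (`seriesParallel`). Hence `a * m ≤ S ≤ b * m` for `m` levels. Influence is easiest
to follow on conductances: a change in one branch reaches the whole tree at most halved
(`abs_inv_sub_inv_le_of_branch`). Take an edge above a word of length `k`. It tops a tree with `m -
k` levels, whose conductance it changes by at most `(b - a) / (a * (m - k)) ^ 2`; this reaches the
root with a factor `2 ^ (-k)`. Returning to resistances costs at most `(b * m) ^ 2`, and `m / (m -
k) ≤ k + 1`, so the oscillation is at most `K * (k + 1) ^ 2 / 2 ^ k` (`abs_seriesParallel_sub_le`).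
With `2 ^ k` such edges, the squares are dominated by the convergent series of `(k + 1) ^ 4 / 2 ^ k`
(`sum_sq_le`).

The recursion is identified with the effective resistance by writing down the potential explicitly
and using uniqueness of the voltage (`resistance_eq_seriesParallel`). -/

open scoped NNReal

/-! ### McDiarmid's inequality -/

namespace BoundedDifferences

/-- A function all of whose values are within `c` of each other deviates from its mean in a
sub-Gaussian way. -/
lemma hasSubgaussianMGF_of_abs_sub_le {α : Type*} [MeasurableSpace α] (μ : Measure α)
    [IsProbabilityMeasure μ] {f : α → ℝ} (hf : Measurable f) {c : ℝ≥0}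
    (hc : ∀ x x', |f x - f x'| ≤ c) :
    HasSubgaussianMGF (fun x => f x - ∫ x', f x' ∂μ) ((c / 2) ^ 2) μ := by
  have hne : Nonempty α := nonempty_of_isProbabilityMeasure μ
  have x₀ : α := hne.some
  have hbdd : BddBelow (Set.range f) := by
    refine ⟨f x₀ - c, ?_⟩
    rintro _ ⟨x, rfl⟩
    have := (abs_le.1 (hc x₀ x)).2
    linarith
  -- All values lie in an interval of length `c` starting at the infimum, so Hoeffding's lemma
  -- applies.
  have h : ∀ x, f x ∈ Set.Icc (⨅ x, f x) ((⨅ x, f x) + c) := by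
    intro x
    refine ⟨ciInf_le hbdd x, ?_⟩
    have : f x - c ≤ ⨅ x, f x := le_ciInf fun y => by
      have := (abs_le.1 (hc x y)).2
      linarith
    linarith
  have := hasSubgaussianMGF_of_mem_Icc (μ := μ) hf.aemeasurable (ae_of_all _ h)
  simpa using this

lemma integrable_of_abs_le {α : Type*} [MeasurableSpace α] (μ : Measure α)
    [IsFiniteMeasure μ] {f : α → ℝ} (hf : Measurable f) {M : ℝ} (hM : ∀ z, |f z| ≤ M) :
    Integrable f μ :=
  Integrable.of_bound hf.aestronglyMeasurable M (ae_of_all _ hM)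

lemma integrable_exp_of_abs_le {α : Type*} [MeasurableSpace α] (μ : Measure α)
    [IsFiniteMeasure μ] {f : α → ℝ} (hf : Measurable f) {M : ℝ} (hM : ∀ z, |f z| ≤ M) :
    Integrable (fun z => Real.exp (f z)) μ :=
  integrable_of_abs_le μ (hf.exp) (M := Real.exp M) fun z => by
    rw [Real.abs_exp]
    exact Real.exp_le_exp.2 (abs_le.1 (hM z)).2

/-- Induction step of McDiarmid: conditionally on `y`, Hoeffding's lemma controls the fluctuation in
`x`, and `hg` controls the conditional mean, so the variance proxies add. -/
lemma hasSubgaussianMGF_prod {α β : Type*} [MeasurableSpace α] [MeasurableSpace β]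
    (μ : Measure α) [IsProbabilityMeasure μ] (ν : Measure β) [IsProbabilityMeasure ν]
    {f : α × β → ℝ} (hf : Measurable f) {M : ℝ} (hM : ∀ z, |f z| ≤ M) {c C : ℝ≥0}
    (hc : ∀ y x x', |f (x, y) - f (x', y)| ≤ c)
    (hg : HasSubgaussianMGF (fun y => (∫ x, f (x, y) ∂μ) - ∫ y', ∫ x, f (x, y') ∂μ ∂ν) C ν) :
    HasSubgaussianMGF (fun z => f z - ∫ z', f z' ∂(μ.prod ν)) ((c / 2) ^ 2 + C) (μ.prod ν) := by
  have hfi : Integrable f (μ.prod ν) := integrable_of_abs_le _ hf hM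
  have hexp : ∀ t : ℝ, Integrable
      (fun z => Real.exp (t * (f z - ∫ z', f z' ∂(μ.prod ν)))) (μ.prod ν) := by
    intro t
    refine integrable_exp_of_abs_le _ (by fun_prop)
      (M := |t| * (M + |∫ z', f z' ∂(μ.prod ν)|)) fun z => ?_
    rw [abs_mul]
    gcongr
    exact (abs_sub _ _).trans (by gcongr; exact hM z)
  refine ⟨hexp, fun t => ?_⟩
  have hI : ∫ z', f z' ∂(μ.prod ν) = ∫ y', ∫ x, f (x, y') ∂μ ∂ν := integral_prod_symm f hfi
  rw [mgf, integral_prod_symm _ (hexp t), hI]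
  set m := ∫ y', ∫ x, f (x, y') ∂μ ∂ν with hm
  have hinner : ∀ y, ∫ x, Real.exp (t * (f (x, y) - m)) ∂μ ≤
      Real.exp (t * ((∫ x, f (x, y) ∂μ) - m)) * Real.exp ((c / 2) ^ 2 * t ^ 2 / 2) := by
    intro y
    have h1 := (hasSubgaussianMGF_of_abs_sub_le μ (f := fun x => f (x, y))
      (hf.comp measurable_prodMk_right) (hc y)).mgf_le t
    rw [mgf] at h1
    push_cast at h1
    calc ∫ x, Real.exp (t * (f (x, y) - m)) ∂μ
        = ∫ x, Real.exp (t * ((∫ x, f (x, y) ∂μ) - m)) *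
            Real.exp (t * (f (x, y) - ∫ x, f (x, y) ∂μ)) ∂μ := by
          congr 1 with x
          rw [← Real.exp_add]
          ring_nf
      _ = Real.exp (t * ((∫ x, f (x, y) ∂μ) - m)) *
            ∫ x, Real.exp (t * (f (x, y) - ∫ x, f (x, y) ∂μ)) ∂μ := integral_const_mul _ _
      _ ≤ _ := by gcongr
  calc ∫ y, ∫ x, Real.exp (t * (f (x, y) - m)) ∂μ ∂ν
      ≤ ∫ y, Real.exp (t * ((∫ x, f (x, y) ∂μ) - m)) * Real.exp ((c / 2) ^ 2 * t ^ 2 / 2) ∂ν := by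
        refine integral_mono ?_ ((hg.integrable_exp_mul t).mul_const _) hinner
        rw [← hI]
        exact (hexp t).integral_prod_right
    _ = (∫ y, Real.exp (t * ((∫ x, f (x, y) ∂μ) - m)) ∂ν) *
          Real.exp ((c / 2) ^ 2 * t ^ 2 / 2) := integral_mul_const _ _
    _ ≤ Real.exp (C * t ^ 2 / 2) * Real.exp ((c / 2) ^ 2 * t ^ 2 / 2) := by
        gcongr
        exact hg.mgf_le t
    _ = _ := by
        rw [← Real.exp_add]
        push_cast
        ring_nf

/-- McDiarmid's inequality, in its sub-Gaussian form, for a product of probability measures. -/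
theorem hasSubgaussianMGF_pi {α : Type*} [MeasurableSpace α] :
    ∀ (n : ℕ) (μ : Fin n → Measure α) [∀ i, IsProbabilityMeasure (μ i)] (f : (Fin n → α) → ℝ)
      (_ : Measurable f) (M : ℝ) (_ : ∀ y, |f y| ≤ M) (c : Fin n → ℝ≥0)
      (_ : ∀ i y z, (∀ j ≠ i, y j = z j) → |f y - f z| ≤ c i),
      HasSubgaussianMGF (fun y => f y - ∫ y', f y' ∂(Measure.pi μ)) (∑ i, (c i / 2) ^ 2)
        (Measure.pi μ)
  | 0, μ, _, f, _, M, _, c, _ => by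
    have h : ∀ y : Fin 0 → α, f y = f default := fun y => congrArg f (Subsingleton.elim _ _)
    have : (fun y => f y - ∫ y', f y' ∂(Measure.pi μ)) = fun _ => 0 := by
      funext y
      simp [h]
    rw [this, Finset.univ_eq_empty, Finset.sum_empty]
    exact HasSubgaussianMGF.fun_zero
  | n + 1, μ, _, f, hf, M, hM, c, hc => by
    have hmp := measurePreserving_piFinSuccAbove μ 0
    set e := MeasurableEquiv.piFinSuccAbove (fun _ : Fin (n + 1) => α) 0 with he
    have hes : ∀ x (y : Fin n → α), e.symm (x, y) = Fin.cons x y := by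
      intro x y
      simp [he, MeasurableEquiv.piFinSuccAbove_symm_apply, Fin.insertNthEquiv]
    set F : α × (Fin n → α) → ℝ := fun z => f (e.symm z) with hF
    have hFm : Measurable F := hf.comp e.symm.measurable
    have hFM : ∀ z, |F z| ≤ M := fun z => hM _
    set ν := Measure.pi fun j : Fin n => μ j.succ with hν
    have hFi : ∀ y, Integrable (fun x => F (x, y)) (μ 0) := fun y =>
      integrable_of_abs_le _ (hFm.comp measurable_prodMk_right) (fun x => hFM _)
    have hprod : HasSubgaussianMGF (fun z => F z - ∫ z', F z' ∂((μ 0).prod ν))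
        ((c 0 / 2) ^ 2 + ∑ i : Fin n, (c i.succ / 2) ^ 2) ((μ 0).prod ν) := by
      refine hasSubgaussianMGF_prod (μ 0) ν hFm hFM ?_ ?_
      · intro y x x'
        simp only [hF, hes]
        refine hc 0 _ _ fun j hj => ?_
        obtain ⟨k, rfl⟩ := Fin.exists_succ_eq.2 hj
        simp
      -- Averaging out the first coordinate preserves both the bound `M` and the oscillations in the
      -- other coordinates.
      · refine hasSubgaussianMGF_pi n (fun j => μ j.succ) (fun y => ∫ x, F (x, y) ∂(μ 0))
          (hFm.stronglyMeasurable.integral_prod_left').measurable M (fun y => ?_)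
          (fun j => c j.succ) (fun i y z h => ?_)
        · have := norm_integral_le_of_norm_le_const (μ := μ 0) (f := fun x => F (x, y))
            (ae_of_all _ fun x => hFM (x, y))
          simpa using this
        · rw [← integral_sub (hFi y) (hFi z)]
          have := norm_integral_le_of_norm_le_const (μ := μ 0)
            (f := fun x => F (x, y) - F (x, z)) (C := c i.succ) (ae_of_all _ fun x => by
              simp only [hF, hes]
              refine hc i.succ _ _ fun j hj => ?_
              refine Fin.cases (fun _ => by simp) (fun k hk => ?_) j hj
              simp only [Fin.cons_succ]
              exact h k fun hki => hk (by rw [hki]))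
          simpa using this
    have hmap : (Measure.pi μ).map e = (μ 0).prod ν := by
      simpa [hν] using hmp.map_eq
    have hint : ∫ y, f y ∂(Measure.pi μ) = ∫ z, F z ∂((μ 0).prod ν) := by
      rw [← hmap, integral_map_equiv]
      simp [hF]
    rw [← hmap] at hprod
    have := HasSubgaussianMGF.of_map e.measurable.aemeasurable hprod
    rw [hmap, ← hint] at this
    rw [Fin.sum_univ_succ]
    simpa [hF, Function.comp_def] using this

/-- McDiarmid's inequality, in its sub-Gaussian form, for independent random variables. -/
theorem hasSubgaussianMGF_of_iIndepFun {Ω α ι : Type*} [MeasurableSpace Ω] [MeasurableSpace α]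
    [Fintype ι] {P : Measure Ω} [IsProbabilityMeasure P] {X : ι → Ω → α}
    (hX : ∀ i, Measurable (X i)) (hind : iIndepFun X P) {f : (ι → α) → ℝ} (hf : Measurable f)
    {M : ℝ} (hM : ∀ y, |f y| ≤ M) {c : ι → ℝ≥0}
    (hc : ∀ i y z, (∀ j ≠ i, y j = z j) → |f y - f z| ≤ c i) :
    HasSubgaussianMGF (fun ω => f (fun i => X i ω) - ∫ ω', f (fun i => X i ω') ∂P)
      (∑ i, (c i / 2) ^ 2) P := by
  let e := Fintype.equivFin ι
  have hY : ∀ i, Measurable (X (e.symm i)) := fun i => hX _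
  have hmap := (iIndepFun_iff_map_fun_eq_pi_map fun i => (hY i).aemeasurable).1
    (hind.precomp e.symm.injective)
  have : ∀ i, IsProbabilityMeasure (P.map (X (e.symm i))) := fun i =>
    Measure.isProbabilityMeasure_map (hY i).aemeasurable
  have hre : Measurable fun y : Fin (Fintype.card ι) → α => fun i => y (e i) := by fun_prop
  have hfm : Measurable fun y : Fin (Fintype.card ι) → α => f fun i => y (e i) := hf.comp hre
  have h := hasSubgaussianMGF_pi (Fintype.card ι) (fun i => P.map (X (e.symm i)))
    (fun y => f fun i => y (e i)) hfm M (fun y => hM _) (fun i => c (e.symm i))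
    (fun i y z h => hc _ _ _ fun j hj => h _ fun hji => hj (by simp [← hji]))
  have hYm : Measurable fun ω i => X (e.symm i) ω := measurable_pi_lambda _ hY
  rw [← hmap, integral_map hYm.aemeasurable hfm.aestronglyMeasurable] at h
  have h' := HasSubgaussianMGF.of_map hYm.aemeasurable h
  rw [Equiv.sum_comp e.symm fun i => (c i / 2) ^ 2] at h'
  simpa [Function.comp_def] using h'

/-- McDiarmid's inequality: the two-sided deviation bound. -/
theorem measureReal_lt_abs_sub_integral_le {Ω : Type*} [MeasurableSpace Ω]
    {P : Measure Ω} [IsProbabilityMeasure P] {Y : Ω → ℝ} {s : ℝ≥0} (h : HasSubgaussianMGF Y s P)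
    {t : ℝ} (ht : 0 ≤ t) :
    P.real {ω | t < |Y ω|} ≤ 2 * Real.exp (-t ^ 2 / (2 * s)) := by
  have hsub : {ω | t < |Y ω|} ⊆ {ω | t ≤ Y ω} ∪ {ω | t ≤ (-Y) ω} := by
    intro ω hω
    have hω' : t < |Y ω| := hω
    rcases lt_abs.1 hω' with h | h
    · exact Or.inl h.le
    · exact Or.inr h.le
  calc P.real {ω | t < |Y ω|} ≤ P.real ({ω | t ≤ Y ω} ∪ {ω | t ≤ (-Y) ω}) :=
        measureReal_mono hsub
    _ ≤ P.real {ω | t ≤ Y ω} + P.real {ω | t ≤ (-Y) ω} := measureReal_union_le _ _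
    _ ≤ _ := by
        have h1 := h.measure_ge_le ht
        have h2 := h.neg.measure_ge_le ht
        linarith

end BoundedDifferences

/-! ### The series-parallel recursion and the influence of one edge -/

namespace EdgeRootedTree

/-- The effective resistance of the edge-rooted binary tree with `m` levels of edges, computed from
the parallel and series laws; `x w` is the resistance of the edge above `w`, without its factor
`2 ^ w.length`. -/
noncomputable def seriesParallel : ℕ → (List Bool → ℝ) → ℝ
  -- With no levels the root is itself a leaf. For one level the quotient below is `0 / 0 = 0`, so
  -- the value is `x []`, as it should be.
  | 0, _ => 0
  -- The branches have resistances `2 * u` and `2 * v`, which in parallel give the harmonic mean of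
  -- `u` and `v`.
  | m + 1, x =>
    x [] + 2 * seriesParallel m (fun w => x (false :: w)) * seriesParallel m (fun w => x (true :: w))
      / (seriesParallel m (fun w => x (false :: w)) + seriesParallel m (fun w => x (true :: w)))

lemma seriesParallel_zero (x : List Bool → ℝ) : seriesParallel 0 x = 0 := rfl

lemma seriesParallel_succ (m : ℕ) (x : List Bool → ℝ) :
    seriesParallel (m + 1) x = x [] +
      2 * seriesParallel m (fun w => x (false :: w)) * seriesParallel m (fun w => x (true :: w)) /
      (seriesParallel m (fun w => x (false :: w)) + seriesParallel m (fun w => x (true :: w))) :=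
  rfl

lemma le_harmonicMean {L u v : ℝ} (hL : 0 ≤ L) (hu : L ≤ u) (hv : L ≤ v) :
    L ≤ 2 * u * v / (u + v) := by
  rcases hL.eq_or_lt with rfl | hL
  · positivity
  · rw [le_div_iff₀ (by linarith)]
    nlinarith [mul_nonneg (hL.le.trans hu) (sub_nonneg.2 hv),
      mul_nonneg (hL.le.trans hv) (sub_nonneg.2 hu)]

lemma harmonicMean_le {L u v : ℝ} (hu : 0 ≤ u) (hv : 0 ≤ v) (hu' : u ≤ L) (hv' : v ≤ L) :
    2 * u * v / (u + v) ≤ L := by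
  rcases (add_nonneg hu hv).eq_or_lt with h | h
  · rw [← h, div_zero]
    exact hu.trans hu'
  · rw [div_le_iff₀ h]
    nlinarith [mul_nonneg hu (sub_nonneg.2 hv'), mul_nonneg hv (sub_nonneg.2 hu')]

/-- A harmonic mean is at least the smaller of its arguments, so every level adds at least `a`. The
case `a = 0` serves as nonnegativity. -/
lemma le_seriesParallel {a : ℝ} (ha : 0 ≤ a) :
    ∀ (m : ℕ) (x : List Bool → ℝ) (_ : ∀ w, w.length < m → a ≤ x w), a * m ≤ seriesParallel m x
  | 0, x, _ => by simp [seriesParallel_zero]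
  | m + 1, x, hx => by
    have h0 := le_seriesParallel ha m (fun w => x (false :: w)) fun w hw => hx _ (by simpa using hw)
    have h1 := le_seriesParallel ha m (fun w => x (true :: w)) fun w hw => hx _ (by simpa using hw)
    have := le_harmonicMean (by positivity) h0 h1
    have := hx [] (by simp)
    rw [seriesParallel_succ]
    push_cast
    linarith

lemma seriesParallel_le {b : ℝ} :
    ∀ (m : ℕ) (x : List Bool → ℝ) (_ : ∀ w, w.length < m → 0 ≤ x w)
      (_ : ∀ w, w.length < m → x w ≤ b), seriesParallel m x ≤ b * m
  | 0, x, _, _ => by simp [seriesParallel_zero]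
  | m + 1, x, hx0, hx => by
    have h0 := seriesParallel_le m (fun w => x (false :: w))
      (fun w hw => hx0 _ (by simpa using hw)) fun w hw => hx _ (by simpa using hw)
    have h1 := seriesParallel_le m (fun w => x (true :: w))
      (fun w hw => hx0 _ (by simpa using hw)) fun w hw => hx _ (by simpa using hw)
    have g0 := le_seriesParallel le_rfl m (fun w => x (false :: w))
      fun w hw => hx0 _ (by simpa using hw)
    have g1 := le_seriesParallel le_rfl m (fun w => x (true :: w))
      fun w hw => hx0 _ (by simpa using hw)
    rw [zero_mul] at g0 g1
    have := harmonicMean_le g0 g1 h0 h1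
    have := hx [] (by simp)
    rw [seriesParallel_succ]
    push_cast
    linarith

lemma measurable_seriesParallel :
    ∀ (m : ℕ), Measurable (seriesParallel m)
  | 0 => measurable_const
  | m + 1 => by
    have h := measurable_seriesParallel m
    have hc : ∀ c : Bool, Measurable fun x : List Bool → ℝ =>
        seriesParallel m fun w => x (c :: w) := fun c => h.comp (by fun_prop)
    have h0 := hc false
    have h1 := hc true
    exact (measurable_pi_apply []).add (((measurable_const.mul h0).mul h1).div (h0.add h1))

/-- Changing one branch changes the conductance of the tree at most half as much as it changes the
conductance of the branch. -/
lemma abs_inv_sub_inv_le_of_branch {p u u' v : ℝ} (hp : 0 ≤ p) (hu : 0 < u) (hu' : 0 < u')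
    (hv : 0 < v) :
    |(p + 2 * u * v / (u + v))⁻¹ - (p + 2 * u' * v / (u' + v))⁻¹| ≤ |u⁻¹ - u'⁻¹| / 2 := by
  have hA : 0 < 2 * u * v / (u + v) := by positivity
  have hB : 0 < 2 * u' * v / (u' + v) := by positivity
  set A := 2 * u * v / (u + v) with hAdef
  set B := 2 * u' * v / (u' + v) with hBdef
  have e1 : (p + A)⁻¹ - (p + B)⁻¹ = (A⁻¹ - B⁻¹) * ((A / (p + A)) * (B / (p + B))) := by
    field_simp
    ring
  -- The inverse of a harmonic mean is the average of the inverses: this is the source of the factor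
  -- one half.
  have e2 : A⁻¹ - B⁻¹ = (u⁻¹ - u'⁻¹) / 2 := by
    rw [hAdef, hBdef]
    field_simp
    ring
  have hA1 : A / (p + A) ≤ 1 := (div_le_one (by positivity)).2 (by linarith)
  have hB1 : B / (p + B) ≤ 1 := (div_le_one (by positivity)).2 (by linarith)
  have hAB : A / (p + A) * (B / (p + B)) ≤ 1 := mul_le_one₀ hA1 (by positivity) hB1
  rw [e1, e2, abs_mul, abs_of_nonneg (by positivity : 0 ≤ A / (p + A) * (B / (p + B))), abs_div,
    abs_two]
  exact mul_le_of_le_one_right (by positivity) hAB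

lemma abs_inv_sub_inv_le {L u v D : ℝ} (hL : 0 < L) (hu : L ≤ u) (hv : L ≤ v)
    (h : |u - v| ≤ D) : |u⁻¹ - v⁻¹| ≤ D / L ^ 2 := by
  have hu0 := hL.trans_le hu
  have hv0 := hL.trans_le hv
  rw [inv_sub_inv hu0.ne' hv0.ne', abs_div, abs_of_pos (mul_pos hu0 hv0), abs_sub_comm]
  have : L ^ 2 ≤ u * v := by
    rw [sq]
    gcongr
  have hD : 0 ≤ D := (abs_nonneg _).trans h
  gcongr

/-- Changing the resistance of the edge above `w` changes the conductance of the tree by at most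
`2 ^ (-w.length)` times the change of the conductance of the tree rooted at that edge. -/
lemma abs_inv_seriesParallel_sub_le {a b : ℝ} (ha : 0 < a) :
    ∀ (w : List Bool) (m : ℕ) (_ : w.length < m) (x y : List Bool → ℝ)
      (_ : ∀ v, x v ∈ Set.Icc a b) (_ : ∀ v, y v ∈ Set.Icc a b) (_ : ∀ v ≠ w, x v = y v),
      |(seriesParallel m x)⁻¹ - (seriesParallel m y)⁻¹| ≤
        (b - a) / (a * (m - w.length)) ^ 2 / 2 ^ w.length
  | [], m, hm, x, y, hx, hy, hxy => by
    obtain ⟨m, rfl⟩ : ∃ k, m = k + 1 := ⟨m - 1, by simp at hm; omega⟩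
    have hLx := le_seriesParallel ha.le (m + 1) x fun w _ => (hx w).1
    have hLy := le_seriesParallel ha.le (m + 1) y fun w _ => (hy w).1
    have h := abs_inv_sub_inv_le (D := b - a) (by positivity) hLx hLy ?_
    · simpa using h
    -- Only the top weight differs, and it enters additively.
    · have e : ∀ c, seriesParallel m (fun w => x (c :: w)) = seriesParallel m (fun w => y (c :: w)) :=
        fun c => congrArg _ (funext fun w => hxy _ (by simp))
      rw [seriesParallel_succ, seriesParallel_succ, e, e, add_sub_add_right_eq_sub, abs_le]
      constructor <;> linarith [(hx []).1, (hx []).2, (hy []).1, (hy []).2]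
  | c :: w, m, hm, x, y, hx, hy, hxy => by
    obtain ⟨m, rfl⟩ : ∃ k, m = k + 1 := ⟨m - 1, by simp at hm; omega⟩
    have hwm : w.length < m := by simpa using hm
    have hm0 : (0 : ℝ) < m := by exact_mod_cast (Nat.zero_le _).trans_lt hwm
    have ih := abs_inv_seriesParallel_sub_le ha w m hwm (fun v => x (c :: v)) (fun v => y (c :: v))
      (fun v => hx _) (fun v => hy _) (fun v hv => hxy _ (by simpa using hv))
    have hr : x [] = y [] := hxy _ (by simp)
    have hp : 0 ≤ y [] := ha.le.trans (hy _).1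
    have hposx : ∀ c, 0 < seriesParallel m (fun w => x (c :: w)) := fun c =>
      (mul_pos ha hm0).trans_le (le_seriesParallel ha.le m _ fun w _ => (hx _).1)
    have hposy : ∀ c, 0 < seriesParallel m (fun w => y (c :: w)) := fun c =>
      (mul_pos ha hm0).trans_le (le_seriesParallel ha.le m _ fun w _ => (hy _).1)
    have key : |(seriesParallel (m + 1) x)⁻¹ - (seriesParallel (m + 1) y)⁻¹| ≤
        |(seriesParallel m (fun w => x (c :: w)))⁻¹ - (seriesParallel m (fun w => y (c :: w)))⁻¹|
          / 2 := by
      rw [seriesParallel_succ, seriesParallel_succ, hr]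
      cases c
      · have e : seriesParallel m (fun w => x (true :: w)) =
            seriesParallel m (fun w => y (true :: w)) :=
          congrArg _ (funext fun w => hxy _ (by simp))
        rw [e]
        exact abs_inv_sub_inv_le_of_branch hp (hposx _) (hposy _) (hposy _)
      · have e : seriesParallel m (fun w => x (false :: w)) =
            seriesParallel m (fun w => y (false :: w)) :=
          congrArg _ (funext fun w => hxy _ (by simp))
        rw [e]
        have := abs_inv_sub_inv_le_of_branch hp (hposx true) (hposy true) (hposy false)
        simpa only [mul_right_comm, add_comm] using this
    refine key.trans ((div_le_div_of_nonneg_right ih zero_le_two).trans_eq ?_)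
    rw [List.length_cons]
    push_cast
    rw [pow_succ 2, div_div _ _ (2 : ℝ), add_sub_add_right_eq_sub]

/-- The oscillation of the effective resistance as a function of the resistance of an edge. -/
lemma abs_seriesParallel_sub_le {a b : ℝ} (ha : 0 < a) (hab : a ≤ b)
    (w : List Bool) (m : ℕ) (hm : w.length < m) (x y : List Bool → ℝ)
    (hx : ∀ v, x v ∈ Set.Icc a b) (hy : ∀ v, y v ∈ Set.Icc a b) (hxy : ∀ v ≠ w, x v = y v) :
    |seriesParallel m x - seriesParallel m y| ≤
      (b - a) * (b / a) ^ 2 * (((w.length : ℝ) + 1) ^ 2 / 2 ^ w.length) := by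
  have hm0 : (0 : ℝ) < m := by exact_mod_cast (Nat.zero_le _).trans_lt hm
  have hk : (1 : ℝ) ≤ (m : ℝ) - w.length := by
    rw [le_sub_iff_add_le]
    exact_mod_cast Nat.one_add_le_iff.2 hm
  have hpx : 0 < seriesParallel m x :=
    (mul_pos ha hm0).trans_le (le_seriesParallel ha.le m _ fun w _ => (hx w).1)
  have hpy : 0 < seriesParallel m y :=
    (mul_pos ha hm0).trans_le (le_seriesParallel ha.le m _ fun w _ => (hy w).1)
  have hlx := seriesParallel_le m x (fun w _ => ha.le.trans (hx w).1) fun w _ => (hx w).2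
  have hly := seriesParallel_le m y (fun w _ => ha.le.trans (hy w).1) fun w _ => (hy w).2
  have h := abs_inv_seriesParallel_sub_le ha w m hm x y hx hy hxy
  have e : seriesParallel m x - seriesParallel m y =
      -(((seriesParallel m x)⁻¹ - (seriesParallel m y)⁻¹) *
        (seriesParallel m x * seriesParallel m y)) := by
    field_simp
    ring
  rw [e, abs_neg, abs_mul, abs_of_pos (mul_pos hpx hpy)]
  have hba : 0 ≤ b - a := sub_nonneg.2 hab
  have hb : 0 < b := ha.trans_le hab
  -- With `k = w.length`, `(k + 1) * (m - k) = m + k * (m - k - 1)`, and the last term is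
  -- nonnegative.
  have hratio : (m : ℝ) / (m - w.length) ≤ w.length + 1 := by
    rw [div_le_iff₀ (by linarith)]
    nlinarith [mul_nonneg (Nat.cast_nonneg (α := ℝ) w.length) (sub_nonneg.2 hk)]
  calc _ ≤ (b - a) / (a * (m - w.length)) ^ 2 / 2 ^ w.length * ((b * m) * (b * m)) := by
        gcongr
    _ = (b - a) * (b / a) ^ 2 * (((m : ℝ) / (m - w.length)) ^ 2 / 2 ^ w.length) := by
        field_simp
    _ ≤ _ := by
        have : 0 ≤ (m : ℝ) / (m - w.length) := div_nonneg hm0.le (by linarith)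
        gcongr

end EdgeRootedTree

/-! ### The explicit potential and the effective resistance -/

namespace EdgeRootedTree

/-- The potential at the lower endpoint of the first edge, for a unit potential at the root. -/
noncomputable def topPotential (m : ℕ) (x : List Bool → ℝ) : ℝ :=
  (seriesParallel m x - x []) / seriesParallel m x

/-- The potential at the node `w` of the tree with `m` levels of edges, for a unit potential at the
root and the potential `0` at the leaves. -/
noncomputable def wordPotential : List Bool → ℕ → (List Bool → ℝ) → ℝ
  | [], m, x => topPotential m x
  -- The branch `c` is again an edge-rooted tree, with one level fewer; by linearity its potential
  -- is the unit one times the potential at its root.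
  | c :: w, m, x => topPotential m x * wordPotential w (m - 1) (fun v => x (c :: v))

/-- The potential at the parent of the node `w`. -/
noncomputable def parentPotential (w : List Bool) (m : ℕ) (x : List Bool → ℝ) : ℝ :=
  if w = [] then 1 else wordPotential w.dropLast m x

lemma parentPotential_nil (m : ℕ) (x : List Bool → ℝ) : parentPotential [] m x = 1 := if_pos rfl

lemma parentPotential_cons (c : Bool) (w : List Bool) (m : ℕ) (x : List Bool → ℝ) :
    parentPotential (c :: w) m x =
      topPotential m x * parentPotential w (m - 1) (fun v => x (c :: v)) := by
  cases w with
  | nil => simp [parentPotential, wordPotential]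
  | cons d w => simp [parentPotential, wordPotential]

/-- The current through the edge above `w`, multiplied by `2 ^ w.length`. -/
noncomputable def scaledFlow (w : List Bool) (m : ℕ) (x : List Bool → ℝ) : ℝ :=
  (parentPotential w m x - wordPotential w m x) / x w

lemma scaledFlow_nil {m : ℕ} {x : List Bool → ℝ} (hx : 0 < x []) (hS : 0 < seriesParallel m x) :
    scaledFlow [] m x = (seriesParallel m x)⁻¹ := by
  rw [scaledFlow, parentPotential_nil, wordPotential, topPotential]
  field_simp
  ring

lemma scaledFlow_cons (c : Bool) (w : List Bool) (m : ℕ) (x : List Bool → ℝ) :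
    scaledFlow (c :: w) m x =
      topPotential m x * scaledFlow w (m - 1) (fun v => x (c :: v)) := by
  rw [scaledFlow, scaledFlow, parentPotential_cons, wordPotential]
  ring

lemma seriesParallel_pos {m : ℕ} (hm : 0 < m) {x : List Bool → ℝ} (hx : ∀ w, 0 < x w) :
    0 < seriesParallel m x := by
  obtain ⟨m, rfl⟩ : ∃ k, m = k + 1 := ⟨m - 1, by omega⟩
  have h := fun c : Bool => le_seriesParallel le_rfl m (fun w => x (c :: w)) fun w _ => (hx _).le
  simp only [zero_mul] at h
  have := le_harmonicMean le_rfl (h false) (h true)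
  rw [seriesParallel_succ]
  linarith [hx []]

/-- Kirchhoff's node law: the average appears because the scaling doubles from a node to its
children. At the top it is the parallel law; deeper down both sides carry the same factor
`topPotential`. -/
lemma scaledFlow_eq_add : ∀ (w : List Bool) (m : ℕ) (_ : w.length + 1 < m) (x : List Bool → ℝ)
    (_ : ∀ v, 0 < x v), scaledFlow w m x =
      (scaledFlow (w ++ [false]) m x + scaledFlow (w ++ [true]) m x) / 2
  | [], m, hm, x, hx => by
    obtain ⟨m, rfl⟩ : ∃ k, m = k + 1 := ⟨m - 1, by simp at hm; omega⟩
    have hm0 : 0 < m := by simpa using hm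
    have h := fun c : Bool => seriesParallel_pos hm0 (x := fun w => x (c :: w)) fun w => hx _
    have hS := seriesParallel_pos m.succ_pos hx
    rw [scaledFlow_nil (hx _) hS, List.nil_append, List.nil_append, scaledFlow_cons,
      scaledFlow_cons, Nat.add_sub_cancel, scaledFlow_nil (x := fun v => x (false :: v)) (hx _) (h _),
      scaledFlow_nil (x := fun v => x (true :: v)) (hx _) (h _), topPotential]
    have h0 := h false
    have h1 := h true
    have hE := seriesParallel_succ m x
    generalize seriesParallel (m + 1) x = S at *
    generalize (seriesParallel m fun w => x (false :: w)) = A at *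
    generalize (seriesParallel m fun w => x (true :: w)) = B at *
    have : S - x [] = 2 * A * B / (A + B) := by linarith
    rw [this]
    field_simp
    ring
  | c :: w, m, hm, x, hx => by
    rw [List.cons_append, List.cons_append, scaledFlow_cons, scaledFlow_cons, scaledFlow_cons,
      scaledFlow_eq_add w (m - 1) (by simp at hm; omega) _ fun v => hx _]
    ring

lemma wordPotential_eq_zero : ∀ (w : List Bool) (m : ℕ) (_ : w.length + 1 = m)
    (x : List Bool → ℝ), wordPotential w m x = 0
  | [], m, hm, x => by
    obtain rfl : m = 1 := by simpa using hm.symm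
    simp [wordPotential, topPotential, seriesParallel_succ, seriesParallel_zero]
  | c :: w, m, hm, x => by
    rw [wordPotential, wordPotential_eq_zero w (m - 1) (by simp at hm; omega), mul_zero]

/-- The parent of a node of the binary tree. -/
def parent {n : ℕ} (w : Word n) : Vertex n :=
  if w.1 = [] then none
  else some ⟨w.1.dropLast, (List.dropLast_sublist w.1).length_le.trans_lt w.2⟩

lemma isChild_iff {n : ℕ} (u v : Vertex n) : IsChild u v ↔ ∃ w, v = some w ∧ u = parent w := by
  rcases v with _ | v
  · rcases u with _ | u <;> simp [IsChild]
  · rcases u with _ | u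
    · simp [IsChild, parent]
    · simp only [IsChild, Option.some.injEq, exists_eq_left', parent]
      constructor
      · rintro ⟨c, hc⟩
        simp [hc]
      · intro h
        split_ifs at h with hv
        rw [Option.some.injEq] at h
        refine ⟨v.1.getLast hv, ?_⟩
        rw [h]
        exact (List.dropLast_append_getLast hv).symm

lemma depth_parent {n : ℕ} (w : Word n) : depth (parent w) = w.1.length := by
  unfold parent
  split_ifs with h
  · simp [depth, h]
  · have := List.length_pos_iff.2 h
    simp only [depth, List.length_dropLast]
    omega

lemma parent_ne {n : ℕ} (w : Word n) : parent w ≠ some w := fun h => by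
  have := depth_parent w
  rw [h] at this
  simp [depth] at this

lemma tree_adj_iff {n : ℕ} (u v : Vertex n) : (tree n).Adj u v ↔
    (∃ w, v = some w ∧ u = parent w) ∨ ∃ w, u = some w ∧ v = parent w := by
  rw [tree, SimpleGraph.fromRel_adj, isChild_iff, isChild_iff]
  refine and_iff_right_of_imp ?_
  rintro (⟨w, rfl, rfl⟩ | ⟨w, rfl, rfl⟩)
  · exact parent_ne w
  · exact (parent_ne w).symm

lemma adj_parent {n : ℕ} (w : Word n) : (tree n).Adj (parent w) (some w) :=
  (tree_adj_iff _ _).2 (Or.inl ⟨w, rfl, rfl⟩)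

/-- The edge joining a node of the binary tree to its parent. -/
def edgeAbove {n : ℕ} (w : Word n) : (tree n).edgeSet := ⟨s(parent w, some w), adj_parent w⟩

lemma edgeDepth_edgeAbove {n : ℕ} (w : Word n) : edgeDepth (edgeAbove w) = w.1.length + 1 := by
  change depth (parent w) ⊔ depth (some w) = _
  rw [depth_parent]
  simp [depth]

lemma edgeAbove_injective {n : ℕ} : Function.Injective (edgeAbove (n := n)) := by
  intro w w' h
  have h' : s(parent w, some w) = s(parent w', some w') := congrArg Subtype.val h
  rcases Sym2.eq_iff.1 h' with ⟨-, h⟩ | ⟨h1, h2⟩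
  · exact Option.some.inj h
  · have e1 := congrArg depth h1
    have e2 := congrArg depth h2
    rw [depth_parent] at e1 e2
    simp only [depth] at e1 e2
    omega

lemma edgeAbove_surjective {n : ℕ} : Function.Surjective (edgeAbove (n := n)) := by
  rintro ⟨e, he⟩
  induction e using Sym2.ind with
  | _ u v =>
    rcases (tree_adj_iff u v).1 he with ⟨w, rfl, rfl⟩ | ⟨w, rfl, rfl⟩
    · exact ⟨w, rfl⟩
    · exact ⟨w, Subtype.ext Sym2.eq_swap⟩

lemma tree_connected (n : ℕ) : (tree n).Connected := by
  have key : ∀ (k : ℕ) (u : Vertex n), depth u = k → (tree n).Reachable none u := by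
    intro k
    induction k with
    | zero =>
      rintro (_ | w) h
      · exact SimpleGraph.Reachable.refl _
      · simp [depth] at h
    | succ k ih =>
      rintro (_ | w) h
      · simp [depth] at h
      · refine (ih (parent w) ?_).trans (adj_parent w).reachable
        rw [depth_parent]
        simpa [depth] using h
  refine (SimpleGraph.connected_iff _).2 ⟨fun u v => ?_, ⟨none⟩⟩
  exact (key _ u rfl).symm.trans (key _ v rfl)

/-- The potential on the vertices of the tree. -/
noncomputable def potential (n : ℕ) (y : List Bool → ℝ) : Vertex n → ℝ
  | none => 1
  | some w => wordPotential w.1 n y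

lemma potential_parent {n : ℕ} (y : List Bool → ℝ) (w : Word n) :
    potential n y (parent w) = parentPotential w.1 n y := by
  unfold parent parentPotential
  split_ifs <;> rfl

section Network

variable {n : ℕ} {x : (tree n).edgeSet → ℝ} {y : List Bool → ℝ}

lemma current_parent (hxy : ∀ w : Word n, x (edgeAbove w) = y w.1) (w : Word n) :
    ElectricNetwork.current (tree n) (fun e => 2 ^ (edgeDepth e - 1) * x e) (potential n y)
      (parent w) (some w) = scaledFlow w.1 n y / 2 ^ w.1.length := by
  have e : (⟨s(parent w, some w), adj_parent w⟩ : (tree n).edgeSet) = edgeAbove w := rfl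
  rw [ElectricNetwork.current, dif_pos (adj_parent w), e, edgeDepth_edgeAbove, hxy,
    potential_parent, scaledFlow, Nat.add_sub_cancel, div_div, mul_comm]
  rfl

lemma sum_current_root (hn : 1 ≤ n) (hy : ∀ v, 0 < y v)
    (hxy : ∀ w : Word n, x (edgeAbove w) = y w.1) :
    ∑ v, ElectricNetwork.current (tree n) (fun e => 2 ^ (edgeDepth e - 1) * x e) (potential n y)
      none v = (seriesParallel n y)⁻¹ := by
  have hw : (([] : List Bool).length < n) := hn
  rw [Finset.sum_eq_single (some ⟨[], hw⟩)]
  · have := current_parent hxy ⟨[], hw⟩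
    rw [scaledFlow_nil (hy _) (seriesParallel_pos hn hy)] at this
    simpa [parent] using this
  · intro v _ hv
    rw [ElectricNetwork.current, dif_neg]
    intro h
    rcases (tree_adj_iff _ _).1 h with ⟨w, rfl, hp⟩ | ⟨w, hp, -⟩
    · unfold parent at hp
      split_ifs at hp with hw
      exact hv (congrArg some (Subtype.ext hw))
    · cases hp
  · simp

lemma eq_append_of_parent_eq {w w' : Word n} (h : some w = parent w') :
    ∃ c, w'.1 = w.1 ++ [c] :=
  (isChild_iff (some w) (some w')).2 ⟨w', rfl, h⟩

lemma sum_current_node (hy : ∀ v, 0 < y v) (hxy : ∀ w : Word n, x (edgeAbove w) = y w.1)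
    (w : Word n) (hw : w.1.length + 1 < n) :
    ∑ v, ElectricNetwork.current (tree n) (fun e => 2 ^ (edgeDepth e - 1) * x e) (potential n y)
      (some w) v = 0 := by
  let child : Bool → Word n := fun c => ⟨w.1 ++ [c], by simpa using hw⟩
  have hpar : ∀ c, parent (child c) = some w := by
    intro c
    simp [child, parent]
  have hpc : ∀ c, parent w ≠ some (child c) := by
    intro c h
    have := congrArg depth h
    rw [depth_parent] at this
    simp [depth, child] at this
    omega
  have hcc : (some (child false) : Vertex n) ≠ some (child true) := by
    simp [child]
  -- Only the parent and the two children are neighbours, so the sum has three terms.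
  rw [← Finset.sum_subset (Finset.subset_univ {parent w, some (child false), some (child true)})]
  · rw [Finset.sum_insert (by simpa using ⟨hpc false, hpc true⟩),
      Finset.sum_insert (by simpa using hcc), Finset.sum_singleton,
      ElectricNetwork.current_swap _ _ _ (parent w) (some w), current_parent hxy]
    have h0 := current_parent hxy (child false)
    have h1 := current_parent hxy (child true)
    rw [hpar] at h0 h1
    rw [h0, h1, scaledFlow_eq_add w.1 n hw y hy]
    simp only [child, List.length_append, List.length_singleton, pow_succ]
    field_simp
    ring
  · intro v _ hv
    rw [ElectricNetwork.current, dif_neg]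
    intro h
    simp only [Finset.mem_insert, Finset.mem_singleton, not_or] at hv
    rcases (tree_adj_iff _ _).1 h with ⟨w', rfl, hp⟩ | ⟨w', hw', hp⟩
    · obtain ⟨c, hc⟩ := eq_append_of_parent_eq hp
      have : w' = child c := Subtype.ext hc
      cases c
      · exact hv.2.1 (by rw [this])
      · exact hv.2.2 (by rw [this])
    · obtain rfl := Option.some.inj hw'
      exact hv.1 hp

/-- The effective resistance of the tree is given by the series and parallel laws. -/
theorem resistance_eq_seriesParallel (hn : 1 ≤ n) (hy : ∀ v, 0 < y v)
    (hxy : ∀ w : Word n, x (edgeAbove w) = y w.1) : resistance n x = seriesParallel n y := by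
  have hU : ElectricNetwork.IsVoltage (tree n) (fun e => 2 ^ (edgeDepth e - 1) * x e) {none}
      (leaves n) (potential n y) := by
    refine ⟨?_, ?_, ?_⟩
    · rintro _ rfl
      rfl
    · rintro (_ | w) h
      · simp [leaves, depth] at h
        omega
      · exact wordPotential_eq_zero w.1 n h y
    · rintro (_ | w) h0 h1
      · exact absurd rfl h0
      · refine sum_current_node hy hxy w ?_
        have : w.1.length + 1 ≠ n := h1
        have := w.2
        omega
  have hr : ∀ e : (tree n).edgeSet, 0 < 2 ^ (edgeDepth e - 1) * x e := by
    intro e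
    obtain ⟨w, rfl⟩ := edgeAbove_surjective e
    rw [hxy]
    have := hy w.1
    positivity
  have hdisj : Disjoint ({none} : Set (Vertex n)) (leaves n) := by
    rw [Set.disjoint_singleton_left]
    intro h
    simp [leaves, depth] at h
    omega
  have hex := ElectricNetwork.existsUnique_isVoltage (tree n) (tree_connected n)
    (fun e => 2 ^ (edgeDepth e - 1) * x e) hr {none} (leaves n) hdisj ⟨none, Or.inl rfl⟩
  have hv : ElectricNetwork.voltage (tree n) (fun e => 2 ^ (edgeDepth e - 1) * x e) {none}
      (leaves n) = potential n y :=
    hex.unique (Classical.epsilon_spec hex.exists) hU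
  rw [resistance, ElectricNetwork.effectiveResistance, ElectricNetwork.effectiveConductance, hv]
  -- Quantifying over the instance lets the rewrite match the classical one in
  -- `effectiveConductance`.
  have hf : ∀ _ : DecidablePred fun u : Vertex n => u ∈ ({none} : Set (Vertex n)),
      (Finset.univ.filter fun u : Vertex n => u ∈ ({none} : Set (Vertex n))) = {none} := by
    intro _
    ext u
    simp
  rw [hf, Finset.sum_singleton, sum_current_root hn hy hxy, one_div, inv_inv]

end Network

end EdgeRootedTree

/-! ### Summing the oscillations; clipping the weights -/

namespace EdgeRootedTree

lemma sum_word_length (n : ℕ) (g : ℕ → ℝ) :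
    ∑ w : Word n, g w.1.length = ∑ d ∈ Finset.range n, 2 ^ d * g d := by
  have hmap : ∀ w ∈ (Finset.univ : Finset (Word n)), w.1.length ∈ Finset.range n := fun w _ =>
    Finset.mem_range.2 w.2
  rw [← Finset.sum_fiberwise_of_maps_to hmap]
  refine Finset.sum_congr rfl fun d hd => ?_
  have hd' := Finset.mem_range.1 hd
  have hcard : (Finset.univ.filter fun w : Word n => w.1.length = d).card = 2 ^ d := by
    rw [← Fintype.card_bool, ← card_vector d, ← Finset.card_univ]
    refine Finset.card_bij' (fun w hw => ⟨w.1, (Finset.mem_filter.1 hw).2⟩)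
      (fun v _ => ⟨v.1, by rw [v.2]; exact hd'⟩) ?_ ?_ ?_ ?_
    · exact fun _ _ => Finset.mem_univ _
    · simp
    · exact fun _ _ => rfl
    · exact fun _ _ => rfl
  rw [Finset.sum_congr rfl (g := fun _ => g d) fun w hw => by rw [(Finset.mem_filter.1 hw).2],
    Finset.sum_const, hcard, nsmul_eq_mul]
  push_cast
  rfl

lemma summable_pow_four_div_two_pow : Summable fun d : ℕ => ((d : ℝ) + 1) ^ 4 / 2 ^ d := by
  have h := (summable_nat_add_iff 1).2
    (summable_pow_mul_geometric_of_norm_lt_one (R := ℝ) 4 (r := 1 / 2) (by norm_num))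
  refine (h.mul_left 2).congr fun d => ?_
  push_cast
  rw [pow_succ (1 / 2 : ℝ), one_div, inv_pow]
  ring

/-- The sum over the edges of the squared oscillations is bounded uniformly in the height. -/
lemma sum_sq_le (n : ℕ) (K : ℝ) :
    ∑ w : Word n, (K * (((w.1.length : ℝ) + 1) ^ 2 / 2 ^ w.1.length) / 2) ^ 2 ≤
      K ^ 2 / 4 * ∑' d : ℕ, ((d : ℝ) + 1) ^ 4 / 2 ^ d := by
  rw [sum_word_length n fun d => (K * (((d : ℝ) + 1) ^ 2 / 2 ^ d) / 2) ^ 2]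
  calc _ = K ^ 2 / 4 * ∑ d ∈ Finset.range n, ((d : ℝ) + 1) ^ 4 / 2 ^ d := by
        rw [Finset.mul_sum]
        refine Finset.sum_congr rfl fun d _ => ?_
        field_simp
        ring
    _ ≤ _ := by
        gcongr
        exact summable_pow_four_div_two_pow.sum_le_tsum _ fun d _ => by positivity

/-- Edge weights on all words, with values in `[a, b]`, that agree with `y` where `y` is defined
and has values in `[a, b]`. -/
noncomputable def clippedWeights {a b : ℝ} (hab : a ≤ b) (n : ℕ) (y : Word n → ℝ)
    (w : List Bool) : ℝ :=
  if h : w.length < n then Set.projIcc a b hab (y ⟨w, h⟩) else a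

lemma clippedWeights_mem {a b : ℝ} (hab : a ≤ b) {n : ℕ} (y : Word n → ℝ) (w : List Bool) :
    clippedWeights hab n y w ∈ Set.Icc a b := by
  unfold clippedWeights
  split_ifs
  · exact Subtype.coe_prop _
  · exact ⟨le_rfl, hab⟩

lemma measurable_clippedWeights {a b : ℝ} (hab : a ≤ b) (n : ℕ) :
    Measurable (clippedWeights hab n) := by
  refine measurable_pi_lambda _ fun w => ?_
  unfold clippedWeights
  split_ifs with h
  · have : Measurable fun t : ℝ => (Set.projIcc a b hab t : ℝ) :=
      (continuous_subtype_val.comp continuous_projIcc).measurable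
    exact this.comp (measurable_pi_apply _)
  · exact measurable_const

/-- The oscillation bounds of McDiarmid must hold at every argument, whereas the weights lie in `[a,
b]` only almost surely. Clipping gives a function bounded everywhere that agrees with the resistance
on the relevant event. -/
lemma resistance_eq_of_mem_Icc {a b : ℝ} (ha : 0 < a) (hab : a ≤ b) {n : ℕ} (hn : 1 ≤ n)
    {x : (tree n).edgeSet → ℝ} (hx : ∀ e, x e ∈ Set.Icc a b) :
    resistance n x = seriesParallel n (clippedWeights hab n fun w => x (edgeAbove w)) := by
  refine resistance_eq_seriesParallel hn
    (fun v => ha.trans_le (clippedWeights_mem hab _ v).1) fun w => ?_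
  rw [clippedWeights, dif_pos w.2, Set.projIcc_of_mem hab (hx _)]

end EdgeRootedTree

/-! ### The concentration inequality -/

theorem theorem7 (a b : ℝ) (ha : 0 < a) (hab : a < b) :
    ∃ C : ℝ, 0 < C ∧
      ∀ (Ω : Type*) [MeasurableSpace Ω] (P : Measure Ω) [IsProbabilityMeasure P]
        (n : ℕ) (_ : 1 ≤ n) (X : (EdgeRootedTree.tree n).edgeSet → Ω → ℝ)
        (_ : ∀ e, Measurable (X e))
        (_ : ∀ e, ∀ᵐ ω ∂P, X e ω ∈ Set.Icc a b)
        (_ : ∀ e e', IdentDistrib (X e) (X e') P P)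
        (_ : iIndepFun X P),
        Integrable (fun ω => EdgeRootedTree.resistance n (fun e => X e ω)) P ∧
          ∀ t : ℝ, 0 < t →
            P.real {ω | t < |EdgeRootedTree.resistance n (fun e => X e ω)
                - ∫ ω', EdgeRootedTree.resistance n (fun e => X e ω') ∂P|}
              ≤ 2 * Real.exp (-(t ^ 2 / (4 * C))) := by
  have hb : 0 < b := ha.trans hab
  have hK : 0 < (b - a) * (b / a) ^ 2 := mul_pos (sub_pos.2 hab) (by positivity)
  set K := (b - a) * (b / a) ^ 2 with hKdef
  set A := ∑' d : ℕ, ((d : ℝ) + 1) ^ 4 / 2 ^ d with hA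
  have hA0 : 0 < A := EdgeRootedTree.summable_pow_four_div_two_pow.tsum_pos
    (fun d => by positivity) 0 (by norm_num)
  -- The variance proxy is at most `s = K ^ 2 / 4 * A`, and the tail exponent `t ^ 2 / (2 * s)` is
  -- `t ^ 2 / (4 * C)` for `C = s / 2`.
  refine ⟨K ^ 2 / 4 * A / 2, by positivity, ?_⟩
  intro Ω _ P _ n hn X hX hXab _ hind
  set f : (EdgeRootedTree.Word n → ℝ) → ℝ := fun y =>
    EdgeRootedTree.seriesParallel n (EdgeRootedTree.clippedWeights hab.le n y) with hf
  have hmem := fun y => EdgeRootedTree.clippedWeights_mem hab.le (n := n) y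
  have hfm : Measurable f := (EdgeRootedTree.measurable_seriesParallel n).comp
    (EdgeRootedTree.measurable_clippedWeights hab.le n)
  have hfM : ∀ y, |f y| ≤ b * n := by
    intro y
    have h0 := EdgeRootedTree.le_seriesParallel le_rfl n (EdgeRootedTree.clippedWeights hab.le n y)
      fun w _ => ha.le.trans (hmem y w).1
    rw [zero_mul] at h0
    rw [abs_of_nonneg h0]
    exact EdgeRootedTree.seriesParallel_le n _ (fun w _ => ha.le.trans (hmem y w).1)
      fun w _ => (hmem y w).2
  let c : EdgeRootedTree.Word n → ℝ≥0 := fun w =>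
    ⟨K * (((w.1.length : ℝ) + 1) ^ 2 / 2 ^ w.1.length), by positivity⟩
  have hc : ∀ w y z, (∀ v ≠ w, y v = z v) → |f y - f z| ≤ c w := by
    intro w y z h
    refine EdgeRootedTree.abs_seriesParallel_sub_le ha hab.le w.1 n w.2 _ _ (hmem y) (hmem z) ?_
    intro v hv
    unfold EdgeRootedTree.clippedWeights
    split_ifs with hvn
    · rw [h ⟨v, hvn⟩ fun he => hv (congrArg Subtype.val he)]
    · rfl
  have hsub := BoundedDifferences.hasSubgaussianMGF_of_iIndepFun
    (fun w => hX (EdgeRootedTree.edgeAbove w))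
    (hind.precomp EdgeRootedTree.edgeAbove_injective) hfm hfM hc
  have hcount : Countable (EdgeRootedTree.tree n).edgeSet :=
    EdgeRootedTree.edgeAbove_surjective.countable
  have hae : (fun ω => EdgeRootedTree.resistance n (fun e => X e ω)) =ᵐ[P]
      fun ω => f fun w => X (EdgeRootedTree.edgeAbove w) ω := by
    filter_upwards [ae_all_iff.2 hXab] with ω hω
    exact EdgeRootedTree.resistance_eq_of_mem_Icc ha hab.le hn hω
  have hint : Integrable (fun ω => f fun w => X (EdgeRootedTree.edgeAbove w) ω) P :=
    BoundedDifferences.integrable_of_abs_le P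
      (hfm.comp (measurable_pi_lambda _ fun w => hX _)) fun ω => hfM _
  refine ⟨hint.congr hae.symm, fun t ht => ?_⟩
  have hsub' := hsub.congr (Y := fun ω => EdgeRootedTree.resistance n (fun e => X e ω)
      - ∫ ω', EdgeRootedTree.resistance n (fun e => X e ω') ∂P) (by
    rw [integral_congr_ae hae]
    filter_upwards [hae] with ω hω
    rw [hω])
  have hsum : ((∑ w, (c w / 2) ^ 2 : ℝ≥0) : ℝ) ≤ K ^ 2 / 4 * A := by
    have := EdgeRootedTree.sum_sq_le n K
    rw [NNReal.coe_sum]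
    exact this
  -- The proxy is a denominator, so enlarging it in the exponent requires it to be nonzero; the edge
  -- at the root provides a term.
  have hsum0 : 0 < ((∑ w, (c w / 2) ^ 2 : ℝ≥0) : ℝ) := by
    rw [NNReal.coe_sum]
    refine Finset.sum_pos (fun w _ => ?_) ⟨⟨[], hn⟩, Finset.mem_univ _⟩
    change 0 < (K * (((w.1.length : ℝ) + 1) ^ 2 / 2 ^ w.1.length) / 2) ^ 2
    positivity
  refine (BoundedDifferences.measureReal_lt_abs_sub_integral_le hsub' ht.le).trans ?_
  rw [neg_div]
  have : 4 * (K ^ 2 / 4 * A / 2) = 2 * (K ^ 2 / 4 * A) := by ring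
  rw [this]
  gcongr
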